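/- Let $n\ge 0$, let $M^n$ be a closed (compact, without boundary) smooth manifold and let $F:M\times[0,T)\to\mathbb{R}^{n+1}$, $0<T<\infty$, be a smooth family of embeddings moving by mean curvature, $\partial_t F=-H\nu$, where $\nu$ is a unit normal, $h_{ij}=\langle\partial_i\nu,\partial_jF\rangle$ is the second fundamental form $A$ and $H=g^{ij}h_{ij}$. Write $M_t=F(M,t)$. A family $(N_s)_{s<0}$ of subsets of $\mathbb{R}^{n+1}$ is called a blow-up limit of this flow if there are factors $\lambda_j\to\infty$ and space-time points $(x_j,\tau_j)$ with $\tau_j\le T$ and $\lambda_j^2\tau_j\to\infty$ (for instance $(x_j,\tau_j)=(y_0,T)$ for all $j$) such that for each $s<0$ the rescaled slices $\lambda_j\bigl(M_{\tau_j+s/\lambda_j^2}-x_j\bigr)$, with their $n$-dimensional Hausdorff measures, converge as Radon measures to a Radon measure with support $N_s$. A self-shrinker is a smooth embedded hypersurface without boundary that satisfies $H=\langle x,\nu\rangle$, and $(N_s)_{s<0}$ is called a self-shrinking flow if $N_{-1/2}$ is a self-shrinker and $N_s=\sqrt{-2s}\,N_{-1/2}$ for all $s<0$. Let $(N_s)_{s<0}$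 be a non-empty self-shrinking flow that is a blow-up limit of the closed mean curvature flow $(M_t)$. If there is a time $t_0<0$ with $$\sqrt{-2t_0}\;\sup_{N_{t_0}}|A|<1$$ (that is, $\sup|A|<1$ on the slice normalized so that $H=\langle x,\nu\rangle$; for $t_0=-\tfrac12$ this is $\sup_{N_{t_0}}|A|<1$), then there is a hyperplane $W\subset\mathbb{R}^{n+1}$ through the origin such that $N_t=W$ for all $t<0$. -/

import Mathlib

open scoped Manifold ContDiff Topology

noncomputable section

namespace MCFGap

/-- Euclidean `n`-space. -/
abbrev E (n : ℕ) : Type := EuclideanSpace ℝ (Fin n)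

/-! ### Local geometry of a parametrized hypersurface `f : E n → E (n + 1)` -/

/-- The partial derivative `∂ᵢ f` at `u`. -/
def pd {n : ℕ} (f : E n → E (n + 1)) (i : Fin n) (u : E n) : E (n + 1) :=
  fderiv ℝ f u (EuclideanSpace.single i 1)

/-- The induced metric `gᵢⱼ = ⟨∂ᵢ f, ∂ⱼ f⟩`. -/
def metric {n : ℕ} (f : E n → E (n + 1)) (u : E n) : Matrix (Fin n) (Fin n) ℝ :=
  Matrix.of fun i j => inner ℝ (pd f i u) (pd f j u)

/-- `v` is one of the two unit normal vectors of `f` at `u`. -/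
def IsUnitNormal {n : ℕ} (f : E n → E (n + 1)) (u : E n) (v : E (n + 1)) : Prop :=
  ‖v‖ = 1 ∧ ∀ i, inner ℝ v (pd f i u) = 0

/-- The second fundamental form with respect to the unit normal `v` at `u`,
`hᵢⱼ = - ⟨∂ᵢ ∂ⱼ f, v⟩`. If `ν` is a differentiable unit normal field with `ν u = v`, then
differentiating `⟨ν, ∂ⱼ f⟩ = 0` shows that this is `⟨∂ᵢ ν, ∂ⱼ f⟩`. -/
def secondForm {n : ℕ} (f : E n → E (n + 1)) (u : E n) (v : E (n + 1)) :
    Matrix (Fin n) (Fin n) ℝ :=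
  Matrix.of fun i j =>
    - inner ℝ (fderiv ℝ (fun w => pd f j w) u (EuclideanSpace.single i 1)) v

/-- The mean curvature `H = gⁱʲ hᵢⱼ` with respect to the unit normal `v`. -/
def meanCurvature {n : ℕ} (f : E n → E (n + 1)) (u : E n) (v : E (n + 1)) : ℝ :=
  ∑ i, ∑ j, (metric f u)⁻¹ i j * secondForm f u v i j

/-- The norm of the second fundamental form, `|A|² = gⁱʲ gᵏˡ hᵢₖ hⱼₗ`. -/
def normA {n : ℕ} (f : E n → E (n + 1)) (u : E n) (v : E (n + 1)) : ℝ :=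
  Real.sqrt (∑ i, ∑ j, ∑ k, ∑ l, (metric f u)⁻¹ i j * (metric f u)⁻¹ k l *
    secondForm f u v i k * secondForm f u v j l)

/-! ### Embedded hypersurfaces and self-shrinkers -/

/-- `f`, restricted to the open set `V`, is a smooth parametrization of a relatively open part
of `S`: an immersion that is a homeomorphism onto `S ∩ U` for some open set `U`. -/
structure IsLocalParam {n : ℕ} (S : Set (E (n + 1))) (f : E n → E (n + 1))
    (V : Set (E n)) : Prop where
  isOpen : IsOpen V
  smooth : ContDiffOn ℝ ∞ f V
  immersion : ∀ u ∈ V, Function.Injective (fderiv ℝ f u)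
  embedding : Topology.IsEmbedding (V.domRestrict f)
  image : ∃ U : Set (E (n + 1)), IsOpen U ∧ f '' V = S ∩ U

/-- `S` is a smooth embedded hypersurface (without boundary) of `E (n + 1)`. -/
def IsSmoothHypersurface {n : ℕ} (S : Set (E (n + 1))) : Prop :=
  ∀ x ∈ S, ∃ f V, IsLocalParam S f V ∧ x ∈ f '' V

/-- `S` is a self-shrinker: a smooth embedded hypersurface with `H = ⟨x, ν⟩`. (The equation is
unchanged when `ν` is replaced by `-ν`.) -/
structure IsSelfShrinker {n : ℕ} (S : Set (E (n + 1))) : Prop where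
  hypersurface : IsSmoothHypersurface S
  equation : ∀ f V, IsLocalParam S f V → ∀ u ∈ V, ∀ v, IsUnitNormal f u v →
    meanCurvature f u v = inner ℝ (f u) v

/-- `(N t)`, `t < 0`, is a self-shrinking flow that disappears at `(0, 0)`:
`N t = √(-2t) N (-1/2)`, and `N (-1/2)` is a self-shrinker. -/
structure IsSelfShrinkingFlow {n : ℕ} (N : ℝ → Set (E (n + 1))) : Prop where
  selfShrinker : IsSelfShrinker (N (-1 / 2))
  scaling : ∀ t < 0, N t = (fun x => Real.sqrt (-2 * t) • x) '' N (-1 / 2)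

/-- The set of values of `|A|` on the hypersurface `S`. -/
def valuesA {n : ℕ} (S : Set (E (n + 1))) : Set ℝ :=
  {a | ∃ f V u v, IsLocalParam S f V ∧ u ∈ V ∧ IsUnitNormal f u v ∧ a = normA f u v}

/-! ### Closed mean curvature flows and their blow-up limits -/

/-- The immersion `F(·, t)` read in the preferred chart of `M` at `p`. -/
def inChart {n : ℕ} {M : Type*} [TopologicalSpace M] [ChartedSpace (E n) M]
    (F : M → ℝ → E (n + 1)) (t : ℝ) (p : M) : E n → E (n + 1) :=
  fun w => F ((extChartAt (𝓡 n) p).symm w) t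

/-- `F : M × [0, T) → E (n + 1)` is a smooth family of embeddings of the closed manifold `M`
that moves by mean curvature, `∂F/∂t = - H ν`. (The right-hand side is unchanged when `ν` is
replaced by `-ν`; an injective immersion of a compact manifold is an embedding.) -/
structure IsMeanCurvatureFlow {n : ℕ} {M : Type*} [TopologicalSpace M] [ChartedSpace (E n) M]
    (F : M → ℝ → E (n + 1)) (T : ℝ) : Prop where
  pos : 0 < T
  smooth : ContMDiffOn ((𝓡 n).prod 𝓘(ℝ, ℝ)) 𝓘(ℝ, E (n + 1)) ∞
    (fun q : M × ℝ => F q.1 q.2) (Set.univ ×ˢ Set.Ico 0 T)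
  injective : ∀ t ∈ Set.Ico 0 T, Function.Injective (fun p => F p t)
  immersion : ∀ t ∈ Set.Ico 0 T, ∀ p : M,
    Function.Injective (mfderiv (𝓡 n) 𝓘(ℝ, E (n + 1)) (fun p => F p t) p)
  equation : ∀ t ∈ Set.Ico 0 T, ∀ p : M, ∀ v,
    IsUnitNormal (inChart F t p) (extChartAt (𝓡 n) p p) v →
    HasDerivWithinAt (F p)
      (-(meanCurvature (inChart F t p) (extChartAt (𝓡 n) p p) v) • v) (Set.Ico 0 T) t

/-- The time `s` slice of the flow `F` after the parabolic rescaling by the factor `c` about the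
space-time point `(x, τ)`, that is, `c (M_{τ + s / c²} - x)`. -/
def rescaledSlice {n : ℕ} {M : Type*} (F : M → ℝ → E (n + 1)) (c : ℝ) (x : E (n + 1))
    (τ s : ℝ) : Set (E (n + 1)) :=
  Set.range fun p : M => c • (F p (τ + s / c ^ 2) - x)

open MeasureTheory in
/-- `(N s)`, `s < 0`, is a blow-up limit of the flow `F` on `[0, T)`: there are parabolic
rescalings of the flow, with factors `c j → ∞` about points `(x j, τ j)` with `τ j ≤ T`, whose
time slices exist at each fixed `s < 0` for all large `j` (this is `c j ^ 2 * τ j → ∞`) and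
converge, as Radon measures, to a measure with support `N s`. No bound on the multiplicity of
the limit is asked for. The classical case is `x j = y₀` and `τ j = T` for all `j`. -/
def IsBlowUpLimit {n : ℕ} {M : Type*} (F : M → ℝ → E (n + 1)) (T : ℝ)
    (N : ℝ → Set (E (n + 1))) : Prop :=
  ∃ (c : ℕ → ℝ) (x : ℕ → E (n + 1)) (τ : ℕ → ℝ),
    Filter.Tendsto c Filter.atTop Filter.atTop ∧
    (∀ j, τ j ≤ T) ∧
    Filter.Tendsto (fun j => c j ^ 2 * τ j) Filter.atTop Filter.atTop ∧
    ∀ s < 0, ∃ μ : Measure (E (n + 1)), IsLocallyFiniteMeasure μ ∧ N s = μ.support ∧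
      ∀ φ : E (n + 1) → ℝ, Continuous φ → HasCompactSupport φ →
        Filter.Tendsto
          (fun j => ∫ y in rescaledSlice F (c j) (x j) (τ j) s, φ y ∂(Measure.hausdorffMeasure (n : ℝ)))
          Filter.atTop (𝓝 (∫ y, φ y ∂μ))

end MCFGap

end

namespace MCFGap

variable {n : ℕ} {S : Set (E (n + 1))} {f : E n → E (n + 1)} {V : Set (E n)}

/-! ### Local parametrizations and unit normals -/

/-! The blow-up property enters only through closedness: a slice is the support of a measure. The
rest is a maximum principle on the closed, possibly noncompact, self-shrinker `S = N (-1/2)`,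
followed by the rigidity of smooth cones.

On `S` put `H = ⟨x, ν⟩` and `L = Δ - ⟨x, ∇ ·⟩`. Then `L H = (1 - |A|²) H`, so `L H² = 2 |∇H|² + 2 (1
- |A|²) H²`, while `L |x|² = 2n - 2 |x|²`. At a maximum of `H² - ε |x|²` this gives `(1 - |A|²) H² ≤
n ε` (`inner_sq_mul_le_of_max`). The maximum exists because `H² ≤ n |A|²` is bounded and `S` is
closed. Letting `ε → 0` gives `H = 0` (`inner_eq_zero_of_secondForm_bound`). No integration is
involved, so no area growth or multiplicity bound is needed.

If `H = 0`, the position vector is tangent to `S`, so `S` is a cone (`smul_mem_of_inner_eq_zero`).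
Being closed and non-empty it contains `0`, and a cone smooth at its vertex is its tangent
hyperplane there (`eq_hyperplane_of_inner_eq_zero`).

The differential identities are not computed with `Δ`. Near a point, `S` is a graph over its tangent
hyperplane, and one-variable derivative tests in the coordinate directions are summed. A global
choice of `ν` is avoided by maximizing over all pairs (point, unit normal). -/

theorem IsLocalParam.contDiffAt (h : IsLocalParam S f V) {u : E n} (hu : u ∈ V) :
    ContDiffAt ℝ ∞ f u :=
  h.smooth.contDiffAt (h.isOpen.mem_nhds hu)

theorem IsLocalParam.differentiableAt (h : IsLocalParam S f V) {u : E n} (hu : u ∈ V) :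
    DifferentiableAt ℝ f u :=
  (h.contDiffAt hu).differentiableAt (by simp)

theorem IsLocalParam.mem (h : IsLocalParam S f V) {u : E n} (hu : u ∈ V) : f u ∈ S := by
  obtain ⟨U, -, hU⟩ := h.image
  exact (hU ▸ Set.mem_image_of_mem f hu : f u ∈ S ∩ U).1

theorem IsLocalParam.exists_image_eq (h : IsLocalParam S f V) {V' : Set (E n)}
    (hV' : IsOpen V') (hsub : V' ⊆ V) : ∃ U, IsOpen U ∧ f '' V' = S ∩ U := by
  obtain ⟨U, hU, hUeq⟩ := h.image
  obtain ⟨U₁, hU₁, hU₁eq⟩ :=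
    h.embedding.isInducing.isOpen_iff.1 (hV'.preimage (continuous_subtype_val (p := (· ∈ V))))
  have key : ∀ u ∈ V, f u ∈ U₁ ↔ u ∈ V' := fun u hu =>
    (Set.ext_iff.1 hU₁eq ⟨u, hu⟩)
  refine ⟨U ∩ U₁, hU.inter hU₁, ?_⟩
  ext y
  constructor
  · rintro ⟨u, hu, rfl⟩
    have h1 : f u ∈ S ∩ U := hUeq ▸ Set.mem_image_of_mem f (hsub hu)
    exact ⟨h1.1, h1.2, (key u (hsub hu)).2 hu⟩
  · rintro ⟨hy, hyU, hyU₁⟩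
    obtain ⟨u, hu, rfl⟩ : y ∈ f '' V := hUeq ▸ ⟨hy, hyU⟩
    exact ⟨u, (key u hu).1 hyU₁, rfl⟩

/-- The inverse of an embedding is continuous, so points of `S` near `f u` have parameters near `u`.
Limits along `S` can thus be computed in the parameter. -/
theorem IsLocalParam.nhdsWithin_le_map (h : IsLocalParam S f V) {u : E n} (hu : u ∈ V) :
    𝓝[S] (f u) ≤ Filter.map f (𝓝 u) := by
  intro A hA
  obtain ⟨V', hV'sub, hV', huV'⟩ :=
    mem_nhds_iff.1 (Filter.inter_mem (Filter.mem_map.1 hA) (h.isOpen.mem_nhds hu))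
  obtain ⟨U, hU, hUeq⟩ := h.exists_image_eq hV' fun w hw => (hV'sub hw).2
  have huU : f u ∈ S ∩ U := hUeq ▸ Set.mem_image_of_mem f huV'
  refine mem_nhdsWithin.2 ⟨U, hU, huU.2, ?_⟩
  rintro y ⟨hyU, hyS⟩
  obtain ⟨w, hw, rfl⟩ : y ∈ f '' V' := hUeq ▸ ⟨hyS, hyU⟩
  exact (hV'sub hw).1

/-- `v` is a unit vector normal to the set `S` at `x`, in the sense that `⟨·, v⟩` has derivative
zero at `x` along `S`. -/
def IsNormalTo (S : Set (E (n + 1))) (x v : E (n + 1)) : Prop :=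
  ‖v‖ = 1 ∧ HasFDerivWithinAt (fun y => inner ℝ y v) (0 : E (n + 1) →L[ℝ] ℝ) S x

theorem hasFDerivAt_inner_const {u : E n} {f' : E n →L[ℝ] E (n + 1)} (hf : HasFDerivAt f f' u)
    (v : E (n + 1)) :
    HasFDerivAt (fun w => inner ℝ (f w) v) ((innerSL ℝ v).comp f') u := by
  have := ((innerSL ℝ v).hasFDerivAt (x := f u)).comp u hf
  refine this.congr_of_eventuallyEq (Filter.Eventually.of_forall fun w => ?_)
  simp [real_inner_comm]

theorem IsUnitNormal.inner_fderiv_eq_zero {u : E n} {v : E (n + 1)} (h : IsUnitNormal f u v)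
    (w : E n) : inner ℝ v (fderiv ℝ f u w) = 0 := by
  have hw : w = ∑ i, w i • EuclideanSpace.single i (1 : ℝ) := by
    simpa using ((EuclideanSpace.basisFun (Fin n) ℝ).sum_repr w).symm
  have h2 : ∀ i, inner ℝ v (fderiv ℝ f u (EuclideanSpace.single i 1)) = 0 := h.2
  rw [hw, map_sum, inner_sum]
  exact Finset.sum_eq_zero fun i _ => by rw [map_smul, inner_smul_right, h2, mul_zero]

/-- For an immersion `w - u = O(f w - f u)`, so a first-order statement in the parameter is one
along `S`. Hence normality does not depend on the parametrization. -/
theorem IsLocalParam.isUnitNormal_iff (h : IsLocalParam S f V) {u : E n} (hu : u ∈ V)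
    (v : E (n + 1)) : IsUnitNormal f u v ↔ IsNormalTo S (f u) v := by
  have hd := (h.differentiableAt hu).hasFDerivAt
  constructor
  · intro hv
    refine ⟨hv.1, ?_⟩
    have h0 : (innerSL ℝ v).comp (fderiv ℝ f u) = 0 := by
      ext w
      simpa using hv.inner_fderiv_eq_zero w
    have h1 := hasFDerivAt_inner_const hd v
    rw [h0] at h1
    obtain ⟨K, -, hK⟩ := (fderiv ℝ f u : E n →ₗ[ℝ] E (n + 1)).injective_iff_antilipschitz.1
      (h.immersion u hu)
    have h2 : (fun w => w - u) =O[𝓝 u] fun w => f w - f u := by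
      have h3 : (fun w => w - u) =O[𝓝 u] fun w => fderiv ℝ f u (w - u) :=
        Asymptotics.IsBigO.of_bound K (Filter.Eventually.of_forall fun w => by
          simpa using hK.le_mul_dist (w - u) 0)
      have h4 : Asymptotics.IsEquivalent (𝓝 u) (fun w => f w - f u) fun w => fderiv ℝ f u (w - u) :=
        (hasFDerivAt_iff_isLittleO.1 hd).trans_isBigO h3
      exact h3.trans h4.isBigO_symm
    have h3 : (fun w => inner ℝ (f w) v - inner ℝ (f u) v) =o[𝓝 u] fun w => f w - f u := by
      have := (hasFDerivAt_iff_isLittleO.1 h1).trans_isBigO h2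
      simpa using this
    refine HasFDerivWithinAt.of_isLittleO ?_
    have h4 : (fun y => inner ℝ y v - inner ℝ (f u) v) =o[Filter.map f (𝓝 u)]
        fun y => y - f u := Asymptotics.isLittleO_map.2 h3
    simpa using h4.mono (h.nhdsWithin_le_map hu)
  · rintro ⟨hv, h1⟩
    refine ⟨hv, fun i => ?_⟩
    have h2 : HasFDerivWithinAt (fun w => inner ℝ (f w) v)
        ((0 : E (n + 1) →L[ℝ] ℝ).comp (fderiv ℝ f u)) V u :=
      h1.comp u hd.hasFDerivWithinAt fun w hw => h.mem hw
    have h3 := (h2.hasFDerivAt (h.isOpen.mem_nhds hu)).unique (hasFDerivAt_inner_const hd v)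
    have h4 := DFunLike.congr_fun h3 (EuclideanSpace.single i 1)
    simpa [pd] using h4.symm

theorem IsLocalParam.continuousAt_pd (h : IsLocalParam S f V) {u : E n} (hu : u ∈ V)
    (i : Fin n) : ContinuousAt (pd f i) u := by
  have h1 : ContDiffOn ℝ 0 (fderiv ℝ f) V := h.smooth.fderiv_of_isOpen h.isOpen (by simp)
  have h2 : ContinuousAt (fderiv ℝ f) u := h1.continuousOn.continuousAt (h.isOpen.mem_nhds hu)
  exact h2.clm_apply continuousAt_const

/-- Failure of orthogonality to some `∂ᵢ f` is an open condition. This closed set is the domain on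
which the maximum is taken. -/
theorem isClosed_normalBundle (hS : IsSmoothHypersurface S) (hcl : IsClosed S) :
    IsClosed {q : E (n + 1) × E (n + 1) | q.1 ∈ S ∧ IsNormalTo S q.1 q.2} := by
  refine isClosed_of_closure_subset ?_
  rintro ⟨x, v⟩ hq
  have hx : x ∈ S := by
    have := closure_mono (t := Prod.fst ⁻¹' S) (fun q hq => hq.1) hq
    rwa [(hcl.preimage continuous_fst).closure_eq] at this
  have hv : ‖v‖ = 1 := by
    have := closure_mono (t := {q : E (n + 1) × E (n + 1) | ‖q.2‖ = 1}) (fun q hq => hq.2.1) hq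
    rwa [(isClosed_eq (by fun_prop) (by fun_prop)).closure_eq] at this
  obtain ⟨f, V, hf, u, hu, rfl⟩ := hS x hx
  refine ⟨hx, (hf.isUnitNormal_iff hu v).1 ⟨hv, fun i => ?_⟩⟩
  by_contra hne
  have hc : ContinuousAt (fun q : E n × E (n + 1) => inner ℝ q.2 (pd f i q.1)) (u, v) :=
    continuousAt_snd.inner (((hf.continuousAt_pd hu i).comp_of_eq continuousAt_fst rfl))
  have h1 : ∀ᶠ q in 𝓝 u ×ˢ 𝓝 v, q.1 ∈ V ∧ inner ℝ q.2 (pd f i q.1) ≠ 0 := by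
    refine (Filter.tendsto_fst.eventually (hf.isOpen.mem_nhds hu)).and ?_
    rw [← nhds_prod_eq]
    exact hc.eventually_ne hne
  have h2 : ∀ᶠ q in 𝓝[S] (f u) ×ˢ 𝓝 v, ¬ IsNormalTo S q.1 q.2 := by
    refine (Filter.prod_mono (hf.nhdsWithin_le_map hu) le_rfl) ?_
    have h3 : Filter.map f (𝓝 u) ×ˢ 𝓝 v = Filter.map (Prod.map f id) (𝓝 u ×ˢ 𝓝 v) := by
      rw [← Filter.prod_map_map_eq', Filter.map_id]
    rw [h3]
    refine Filter.mem_map.2 (h1.mono ?_)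
    rintro ⟨w, v'⟩ ⟨hw, hne'⟩ hn
    exact hne' (((hf.isUnitNormal_iff hw v').2 hn).2 i)
  have h4 : ∀ᶠ q in 𝓝 (f u, v), q.1 ∈ S → ¬ IsNormalTo S q.1 q.2 := by
    rw [nhds_prod_eq]
    obtain ⟨A, hA, B, hB, hAB⟩ := Filter.mem_prod_iff.1 h2
    refine Filter.mem_of_superset
      (Filter.prod_mem_prod (mem_nhdsWithin_iff_eventually.1 hA) hB) ?_
    rintro ⟨y, v'⟩ ⟨hy, hv'⟩ hyS
    exact hAB ⟨hy hyS, hv'⟩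
  obtain ⟨q, hq1, hq2⟩ := ((mem_closure_iff_frequently.1 hq).and_eventually h4).exists
  exact hq2 hq1.1 hq1.2

theorem IsLocalParam.const_smul (h : IsLocalParam S f V) {c : ℝ} (hc : c ≠ 0) :
    IsLocalParam ((fun x => c • x) '' S) (fun u => c • f u) V where
  isOpen := h.isOpen
  smooth := h.smooth.const_smul c
  immersion u hu := by
    have : fderiv ℝ (fun u => c • f u) u = c • fderiv ℝ f u :=
      fderiv_fun_const_smul (h.differentiableAt hu) c
    rw [this]
    exact fun a b hab => h.immersion u hu (smul_right_injective _ hc hab)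
  embedding := (Homeomorph.smulOfNeZero c hc).isEmbedding.comp h.embedding
  image := by
    obtain ⟨U, hU, hUeq⟩ := h.image
    refine ⟨(fun x => c • x) '' U, (Homeomorph.smulOfNeZero c hc).isOpenMap U hU, ?_⟩
    rw [← Set.image_inter (smul_right_injective _ hc), ← hUeq, Set.image_image]

end MCFGap

namespace MCFGap

variable {n : ℕ} {S : Set (E (n + 1))} {f : E n → E (n + 1)} {V : Set (E n)}

/-! ### Graphs over the tangent hyperplane -/

/-- The graph of `φ` over the affine hyperplane through `p` that is parametrized by the linear
isometry `ι`, in the direction `ν`. -/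
noncomputable def graph (p ν : E (n + 1)) (ι : E n →ₗᵢ[ℝ] E (n + 1)) (φ : E n → ℝ) (u : E n) : E (n + 1) :=
  p + ι u + φ u • ν

/-- Near its point `p`, the hypersurface `S` is the graph of `φ` over its tangent hyperplane at
`p`, which is parametrized by `ι` and has unit normal `ν`. -/
structure IsGraphParam (S : Set (E (n + 1))) (p ν : E (n + 1)) (ι : E n →ₗᵢ[ℝ] E (n + 1))
    (φ : E n → ℝ) (V : Set (E n)) : Prop where
  norm_normal : ‖ν‖ = 1
  inner_normal : ∀ u, inner ℝ (ι u) ν = 0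
  smooth : ContDiffOn ℝ ∞ φ V
  zero_mem : (0 : E n) ∈ V
  map_zero : φ 0 = 0
  fderiv_zero : fderiv ℝ φ 0 = 0
  param : IsLocalParam S (graph p ν ι φ) V

theorem exists_isometry_orthogonal {ν : E (n + 1)} (hν : ‖ν‖ = 1) :
    ∃ ι : E n →ₗᵢ[ℝ] E (n + 1), ∀ u, inner ℝ (ι u) ν = 0 := by
  have : Fact (Module.finrank ℝ (E (n + 1)) = n + 1) := ⟨by simp⟩
  have h0 : ν ≠ 0 := by rintro rfl; simp at hν
  have hd : Module.finrank ℝ (Submodule.span ℝ {ν})ᗮ = n := Submodule.finrank_orthogonal_span_singleton h0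
  let b := (stdOrthonormalBasis ℝ (Submodule.span ℝ {ν})ᗮ).reindex (finCongr hd)
  refine ⟨(Submodule.span ℝ {ν})ᗮ.subtypeₗᵢ.comp b.repr.symm.toLinearIsometry, fun u => ?_⟩
  have := (b.repr.symm u).2
  rw [Submodule.mem_orthogonal_singleton_iff_inner_left] at this
  exact this

variable {p ν : E (n + 1)} {ι : E n →ₗᵢ[ℝ] E (n + 1)}

theorem finrank_range_isometry (ι : E n →ₗᵢ[ℝ] E (n + 1)) :
    Module.finrank ℝ (LinearMap.range ι.toLinearMap) = n := by
  rw [LinearMap.finrank_range_of_inj ι.injective]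
  simp

theorem range_isometry_eq (hν : ‖ν‖ = 1) (hι : ∀ u, inner ℝ (ι u) ν = 0) :
    LinearMap.range ι.toLinearMap = (Submodule.span ℝ {ν})ᗮ := by
  have : Fact (Module.finrank ℝ (E (n + 1)) = n + 1) := ⟨by simp⟩
  have h0 : ν ≠ 0 := by rintro rfl; simp at hν
  refine Submodule.eq_of_le_of_finrank_eq ?_ ?_
  · rintro _ ⟨u, rfl⟩
    rw [Submodule.mem_orthogonal_singleton_iff_inner_left]
    exact hι u
  · rw [finrank_range_isometry, Submodule.finrank_orthogonal_span_singleton (n := n) h0]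

/-- The coordinates of the orthogonal projection to the range of `ι`. -/
noncomputable def tangentialPart (ι : E n →ₗᵢ[ℝ] E (n + 1)) : E (n + 1) →L[ℝ] E n :=
  ContinuousLinearMap.adjoint ι.toContinuousLinearMap

theorem inner_tangentialPart (ι : E n →ₗᵢ[ℝ] E (n + 1)) (y : E (n + 1)) (u : E n) :
    inner ℝ (tangentialPart ι y) u = inner ℝ y (ι u) :=
  ContinuousLinearMap.adjoint_inner_left _ _ _

theorem tangentialPart_isometry (ι : E n →ₗᵢ[ℝ] E (n + 1)) (u : E n) :
    tangentialPart ι (ι u) = u :=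
  ext_inner_right ℝ fun w => by rw [inner_tangentialPart, ι.inner_map_map]

theorem tangentialPart_normal (hι : ∀ u, inner ℝ (ι u) ν = 0) : tangentialPart ι ν = 0 :=
  ext_inner_right ℝ fun w => by
    rw [inner_tangentialPart, real_inner_comm, hι, inner_zero_left]

theorem isometry_tangentialPart_add (hν : ‖ν‖ = 1) (hι : ∀ u, inner ℝ (ι u) ν = 0)
    (y : E (n + 1)) : ι (tangentialPart ι y) + inner ℝ y ν • ν = y := by
  have h1 : y - inner ℝ y ν • ν ∈ LinearMap.range ι.toLinearMap := by
    rw [range_isometry_eq hν hι, Submodule.mem_orthogonal_singleton_iff_inner_left,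
      inner_sub_left, inner_smul_left, real_inner_self_eq_norm_sq, hν]
    simp
  obtain ⟨w, hw⟩ := h1
  have hw' : ι w = y - inner ℝ y ν • ν := hw
  have h2 : y = ι w + inner ℝ y ν • ν := by rw [hw']; abel
  have h3 : tangentialPart ι y = w := by
    conv_lhs => rw [h2]
    rw [map_add, tangentialPart_isometry, map_smul, tangentialPart_normal hι, smul_zero, add_zero]
  rw [h3, ← h2]

theorem tangentialPart_graph_sub (hι : ∀ u, inner ℝ (ι u) ν = 0) (φ : E n → ℝ) (u : E n) :
    tangentialPart ι (graph p ν ι φ u - p) = u := by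
  have : graph p ν ι φ u - p = ι u + φ u • ν := by simp only [graph]; abel
  rw [this, map_add, tangentialPart_isometry, map_smul, tangentialPart_normal hι, smul_zero,
    add_zero]

theorem hasFDerivAt_graph {φ : E n → ℝ} {φ' : E n →L[ℝ] ℝ} {u : E n} (h : HasFDerivAt φ φ' u) :
    HasFDerivAt (graph p ν ι φ) (ι.toContinuousLinearMap + φ'.smulRight ν) u :=
  (ι.toContinuousLinearMap.hasFDerivAt.const_add p).add (h.smul_const ν)

theorem fderiv_graph_apply {φ : E n → ℝ} {u : E n} (h : DifferentiableAt ℝ φ u) (w : E n) :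
    fderiv ℝ (graph p ν ι φ) u w = ι w + fderiv ℝ φ u w • ν := by
  rw [(hasFDerivAt_graph h.hasFDerivAt).fderiv]
  simp

/-- Near each of its points, a smooth hypersurface is a graph over its tangent hyperplane. -/
theorem IsLocalParam.exists_isGraphParam (h : IsLocalParam S f V) {u₀ : E n} (hu₀ : u₀ ∈ V)
    (hν : IsUnitNormal f u₀ ν) : ∃ ι φ V', IsGraphParam S (f u₀) ν ι φ V' := by
  obtain ⟨ι, hι⟩ := exists_isometry_orthogonal hν.1
  set π := tangentialPart ι with hπ
  -- Tangential coordinates of the point. The inverse function theorem for `G` at `u₀` turns them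
  -- into parameters of the graph.
  let G : E n → E n := fun w => π (f w - f u₀)
  have hGd : ∀ w ∈ V, HasFDerivAt G (π.comp (fderiv ℝ f w)) w := fun w hw =>
    π.hasFDerivAt.comp w ((h.differentiableAt hw).hasFDerivAt.sub_const _)
  have hGs : ∀ w ∈ V, ContDiffAt ℝ ∞ G w := fun w hw =>
    π.contDiff.contDiffAt.comp w ((h.contDiffAt hw).sub contDiffAt_const)
  have hinj : Function.Injective (π.comp (fderiv ℝ f u₀)) := by
    refine (injective_iff_map_eq_zero _).2 fun w hw => ?_
    have h1 := isometry_tangentialPart_add hν.1 hι (fderiv ℝ f u₀ w)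
    rw [real_inner_comm, hν.inner_fderiv_eq_zero, zero_smul, add_zero] at h1
    have h2 : π (fderiv ℝ f u₀ w) = 0 := hw
    rw [← hπ, h2, _root_.map_zero] at h1
    exact h.immersion u₀ hu₀ (by rw [← h1, _root_.map_zero])
  let e : E n ≃L[ℝ] E n := (LinearEquiv.ofInjectiveEndo _ hinj).toContinuousLinearEquiv
  have he : (e : E n →L[ℝ] E n) = π.comp (fderiv ℝ f u₀) := by ext; rfl
  have hd0 : HasFDerivAt G (e : E n →L[ℝ] E n) u₀ := he ▸ hGd u₀ hu₀
  let Ψ := (hGs u₀ hu₀).toOpenPartialHomeomorph G hd0 (by simp)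
  have hΨ : ∀ w, Ψ w = G w := fun w => rfl
  have hs : u₀ ∈ Ψ.source := (hGs u₀ hu₀).mem_toOpenPartialHomeomorph_source hd0 (by simp)
  have hG0 : G u₀ = 0 := by simp [G]
  -- the points of `V` at which the derivative of `G` is still invertible
  have hev : ∀ᶠ w in 𝓝 u₀, w ∈ V ∧ ∃ e' : E n ≃L[ℝ] E n,
      (e' : E n →L[ℝ] E n) = π.comp (fderiv ℝ f w) := by
    refine (h.isOpen.eventually_mem hu₀).and ?_
    have h1 : ContDiffOn ℝ 0 (fderiv ℝ f) V := h.smooth.fderiv_of_isOpen h.isOpen (by simp)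
    have h2 : ContinuousAt (fun w => π.comp (fderiv ℝ f w)) u₀ :=
      continuousAt_const.clm_comp (h1.continuousOn.continuousAt (h.isOpen.mem_nhds hu₀))
    have h3 := e.nhds
    rw [he] at h3
    exact h2 h3
  obtain ⟨V₁, hV₁, hV₁o, hu₁⟩ := mem_nhds_iff.1 hev
  -- Landing in `V₁` makes the local inverse smooth on all of `V'`, not just at `0`.
  let V' := Ψ.target ∩ Ψ.symm ⁻¹' V₁
  have hV'o : IsOpen V' := Ψ.symm.isOpen_inter_preimage hV₁o
  have hsymm0 : Ψ.symm 0 = u₀ := by rw [← hG0, ← hΨ, Ψ.left_inv hs]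
  have h0V' : (0 : E n) ∈ V' := by
    refine ⟨?_, ?_⟩
    · rw [← hG0, ← hΨ]; exact Ψ.map_source hs
    · simpa [hsymm0] using hu₁
  have hsm : ∀ u ∈ V', ContDiffAt ℝ ∞ Ψ.symm u := fun u hu => by
    obtain ⟨hV, e', he'⟩ := hV₁ hu.2
    exact Ψ.contDiffAt_symm (f₀' := e') hu.1 (he' ▸ hGd _ hV) (hGs _ hV)
  let φ : E n → ℝ := fun u => inner ℝ (f (Ψ.symm u) - f u₀) ν
  have hφs : ∀ u ∈ V', ContDiffAt ℝ ∞ φ u := fun u hu =>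
    (((h.contDiffAt (hV₁ hu.2).1).comp u (hsm u hu)).sub contDiffAt_const).inner ℝ
      contDiffAt_const
  have hgr : ∀ u ∈ V', graph (f u₀) ν ι φ u = f (Ψ.symm u) := fun u hu => by
    have h1 := isometry_tangentialPart_add hν.1 hι (f (Ψ.symm u) - f u₀)
    have h2 : tangentialPart ι (f (Ψ.symm u) - f u₀) = u := Ψ.right_inv hu.1
    rw [h2] at h1
    simp only [graph, φ]
    rw [add_assoc, h1]
    abel
  have hφd : fderiv ℝ φ 0 = 0 := by
    have h1 : HasFDerivAt (fun u => f (Ψ.symm u) - f u₀)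
        ((fderiv ℝ f u₀).comp (fderiv ℝ Ψ.symm 0)) 0 := by
      refine HasFDerivAt.sub_const _ ?_
      refine HasFDerivAt.comp (g := f) 0 ?_
        ((hsm 0 h0V').differentiableAt (by simp)).hasFDerivAt
      rw [hsymm0]
      exact (h.differentiableAt hu₀).hasFDerivAt
    rw [(hasFDerivAt_inner_const h1 ν).fderiv]
    ext w
    simpa using hν.inner_fderiv_eq_zero (fderiv ℝ Ψ.symm 0 w)
  have hgs : ContDiffOn ℝ ∞ (graph (f u₀) ν ι φ) V' := fun u hu =>
    ((contDiffAt_const.add ι.toContinuousLinearMap.contDiff.contDiffAt).add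
      ((hφs u hu).smul contDiffAt_const)).contDiffWithinAt
  refine ⟨ι, φ, V', hν.1, hι, fun u hu => (hφs u hu).contDiffWithinAt, h0V', ?_, hφd,
    hV'o, hgs, fun u hu => ?_, ?_, ?_⟩
  · simp [φ, hsymm0]
  · refine (injective_iff_map_eq_zero _).2 fun w hw => ?_
    rw [fderiv_graph_apply ((hφs u hu).differentiableAt (by simp))] at hw
    have h1 := congrArg (tangentialPart ι) hw
    rwa [map_add, tangentialPart_isometry, map_smul, tangentialPart_normal hι, smul_zero,
      add_zero, _root_.map_zero] at h1
  · refine Topology.IsEmbedding.of_comp (g := fun y => tangentialPart ι (y - f u₀))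
      (continuousOn_iff_continuous_domRestrict.1 hgs.continuousOn) (by fun_prop) ?_
    have : (fun y => tangentialPart ι (y - f u₀)) ∘ V'.domRestrict (graph (f u₀) ν ι φ) =
        Subtype.val := by
      ext1 u
      exact tangentialPart_graph_sub hι φ u
    rw [this]
    exact Topology.IsEmbedding.subtypeVal
  · have h1 : graph (f u₀) ν ι φ '' V' = f '' (Ψ.symm '' V') := by
      rw [Set.image_image]
      exact Set.image_congr hgr
    rw [h1]
    refine h.exists_image_eq (Ψ.symm.isOpen_image_of_subset_source hV'o fun u hu => hu.1) ?_
    rintro _ ⟨u, hu, rfl⟩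
    exact (hV₁ hu.2).1

theorem IsNormalTo.exists_isGraphParam (hS : IsSmoothHypersurface S) (hp : p ∈ S)
    (hν : IsNormalTo S p ν) : ∃ ι φ V, IsGraphParam S p ν ι φ V := by
  obtain ⟨f, V, hf, u, hu, rfl⟩ := hS p hp
  exact hf.exists_isGraphParam hu ((hf.isUnitNormal_iff hu ν).2 hν)

end MCFGap

namespace MCFGap

variable {n : ℕ}

/-! ### Partial derivatives of functions and the second derivative test -/

/-- The partial derivative `∂ᵢ g` of a function. -/
noncomputable def pderiv (g : E n → ℝ) (i : Fin n) (u : E n) : ℝ :=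
  fderiv ℝ g u (EuclideanSpace.single i 1)

section pderiv

variable {g : E n → ℝ} {V : Set (E n)}

theorem contDiffOn_pderiv (hg : ContDiffOn ℝ ∞ g V) (hV : IsOpen V) (i : Fin n) :
    ContDiffOn ℝ ∞ (pderiv g i) V :=
  (hg.fderiv_of_isOpen hV (by simp)).clm_apply contDiffOn_const

theorem differentiableAt_of_contDiffOn (hg : ContDiffOn ℝ ∞ g V) (hV : IsOpen V) {u : E n}
    (hu : u ∈ V) : DifferentiableAt ℝ g u :=
  (hg.contDiffAt (hV.mem_nhds hu)).differentiableAt (by simp)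

theorem fderiv_apply_eq_sum_pderiv (g : E n → ℝ) (u w : E n) :
    fderiv ℝ g u w = ∑ i, w i * pderiv g i u := by
  have hw : w = ∑ i, w i • EuclideanSpace.single i (1 : ℝ) := by
    simpa using ((EuclideanSpace.basisFun (Fin n) ℝ).sum_repr w).symm
  conv_lhs => rw [hw, map_sum]
  exact Finset.sum_congr rfl fun i _ => by rw [map_smul, smul_eq_mul]; rfl

theorem pderiv_comm (hg : ContDiffOn ℝ ∞ g V) (hV : IsOpen V) (i j : Fin n) {u : E n}
    (hu : u ∈ V) : pderiv (pderiv g i) j u = pderiv (pderiv g j) i u := by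
  have hs : IsSymmSndFDerivAt ℝ g u :=
    (hg.contDiffAt (hV.mem_nhds hu)).isSymmSndFDerivAt
      (by simpa using (WithTop.coe_le_coe.2 (le_top : (2 : ℕ∞) ≤ ⊤)))
  have hd : DifferentiableAt ℝ (fderiv ℝ g) u :=
    ((hg.fderiv_of_isOpen (m := ∞) hV (by simp)).contDiffAt (hV.mem_nhds hu)).differentiableAt
      (by simp)
  have key : ∀ i j : Fin n, pderiv (pderiv g i) j u =
      fderiv ℝ (fderiv ℝ g) u (EuclideanSpace.single j 1) (EuclideanSpace.single i 1) := by
    intro i j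
    have h1 := hd.hasFDerivAt.clm_apply
      (hasFDerivAt_const (EuclideanSpace.single i (1 : ℝ)) u)
    have h2 : fderiv ℝ (pderiv g i) u = _ := h1.fderiv
    simp [pderiv, h2]
  rw [key, key]
  exact hs _ _

theorem pderiv_congr {g₁ g₂ : E n → ℝ} (hV : IsOpen V) (h : ∀ u ∈ V, g₁ u = g₂ u) {u : E n}
    (hu : u ∈ V) (i : Fin n) : pderiv g₁ i u = pderiv g₂ i u := by
  have : g₁ =ᶠ[𝓝 u] g₂ := Filter.eventually_of_mem (hV.mem_nhds hu) h
  simp only [pderiv, this.fderiv_eq]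

theorem hasDerivAt_comp_line (hg : ContDiffOn ℝ ∞ g V) (hV : IsOpen V) (k : Fin n) {t : ℝ}
    (ht : t • EuclideanSpace.single k (1 : ℝ) ∈ V) :
    HasDerivAt (fun s : ℝ => g (s • EuclideanSpace.single k (1 : ℝ)))
      (pderiv g k (t • EuclideanSpace.single k (1 : ℝ))) t := by
  have h1 : HasDerivAt (fun s : ℝ => s • EuclideanSpace.single k (1 : ℝ))
      (EuclideanSpace.single k (1 : ℝ)) t := by
    simpa using (hasDerivAt_id t).smul_const (EuclideanSpace.single k (1 : ℝ))
  exact (differentiableAt_of_contDiffOn hg hV ht).hasFDerivAt.comp_hasDerivAt t h1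

theorem eventually_line_mem (hV : IsOpen V) (h0 : (0 : E n) ∈ V) (w : E n) :
    ∀ᶠ t : ℝ in 𝓝 0, t • w ∈ V := by
  have hc : ContinuousAt (fun t : ℝ => t • w) 0 := by fun_prop
  exact hc.eventually_mem (by simpa using hV.mem_nhds h0)

end pderiv

/-- If `K'' > 0`, the point is also a local minimum, so `K` is locally constant and `K'' = 0`. -/
theorem second_deriv_nonpos_of_isLocalMax {K K' : ℝ → ℝ} {K'' : ℝ}
    (hK : ∀ᶠ t in 𝓝 0, HasDerivAt K (K' t) t) (hK' : HasDerivAt K' K'' 0)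
    (hmax : IsLocalMax K 0) : K' 0 = 0 ∧ K'' ≤ 0 := by
  have h0 : K' 0 = 0 := hmax.hasDerivAt_eq_zero hK.self_of_nhds
  refine ⟨h0, ?_⟩
  by_contra! hpos
  have hd : deriv K =ᶠ[𝓝 0] K' := hK.mono fun t ht => ht.deriv
  have hdd : deriv (deriv K) 0 = K'' := by rw [hd.deriv_eq, hK'.deriv]
  have hmin : IsLocalMin K 0 := isLocalMin_of_deriv_deriv_pos (by rw [hdd]; exact hpos)
    (by rw [hd.self_of_nhds, h0]) hK.self_of_nhds.continuousAt
  have hconst : K =ᶠ[𝓝 0] fun _ => K 0 :=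
    hmax.and hmin |>.mono fun t ht => le_antisymm ht.1 ht.2
  have h1 : deriv (deriv K) 0 = 0 := by
    rw [hconst.deriv.deriv_eq]
    simp
  linarith

/-- The first and second order conditions, in one coordinate direction, for
`⟨x, ν⟩² - ε ‖x‖²` to be maximal at the base point of a graph. -/
theorem max_conditions_along_line {n : ℕ} {a b : Fin n → ℝ → ℝ} {c q : Fin n → ℝ} {ψ : ℝ → ℝ}
    {k : Fin n} {p₀ m r ε : ℝ}
    (hψ : ∀ᶠ t in 𝓝 0, HasDerivAt ψ (a k t) t)
    (ha : ∀ i, ∀ᶠ t in 𝓝 0, HasDerivAt (a i) (b i t) t)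
    (hb : ∀ i, HasDerivAt (b i) (c i) 0)
    (hψ0 : ψ 0 = 0) (ha0 : ∀ i, a i 0 = 0) (h0 : m + ε * (r + p₀ ^ 2) = p₀ ^ 2)
    (hmax : ∀ᶠ t in 𝓝 0, (p₀ + ψ t - ∑ i, q i * a i t - t * a k t) ^ 2 ≤
      (m + ε * (r + 2 * t * q k + t ^ 2 + (p₀ + ψ t) ^ 2)) * (1 + ∑ i, a i t ^ 2)) :
    p₀ * (-∑ i, q i * b i 0) = ε * q k ∧
    (∑ i, q i * b i 0) ^ 2 - p₀ * (∑ i, q i * c i + b k 0) - ε * (1 + p₀ * b k 0)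
      - p₀ ^ 2 * ∑ i, b i 0 ^ 2 ≤ 0 := by
  have ha' : ∀ᶠ t in 𝓝 0, ∀ i, HasDerivAt (a i) (b i t) t := Filter.eventually_all.2 ha
  -- In the application `Q` is the position paired with the unnormalized normal `ν - ∇φ`, `P` is the
  -- squared length of that normal, and `R = m + ε |x|²`. Maximality becomes `Q² ≤ R P`, with
  -- equality at `0` and no square roots.
  let Q : ℝ → ℝ := fun t => p₀ + ψ t - ∑ i, q i * a i t - t * a k t
  let Q' : ℝ → ℝ := fun t => -∑ i, q i * b i t - t * b k t
  let R : ℝ → ℝ := fun t => m + ε * (r + 2 * t * q k + t ^ 2 + (p₀ + ψ t) ^ 2)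
  let R' : ℝ → ℝ := fun t => ε * (2 * q k + 2 * t + 2 * (p₀ + ψ t) * a k t)
  let P : ℝ → ℝ := fun t => 1 + ∑ i, a i t ^ 2
  let P' : ℝ → ℝ := fun t => ∑ i, 2 * a i t * b i t
  have hQ : ∀ᶠ t in 𝓝 0, HasDerivAt Q (Q' t) t := by
    filter_upwards [hψ, ha'] with t h1 h2
    have h3 : HasDerivAt (fun t => ∑ i, q i * a i t) (∑ i, q i * b i t) t :=
      HasDerivAt.fun_sum fun i _ => (h2 i).const_mul (q i)
    refine (((h1.const_add p₀).sub h3).sub ((hasDerivAt_id t).mul (h2 k))).congr_deriv ?_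
    simp only [Q', id]
    ring
  have hR : ∀ᶠ t in 𝓝 0, HasDerivAt R (R' t) t := by
    filter_upwards [hψ] with t h1
    have h3 := (((((hasDerivAt_id t).const_mul 2).mul_const (q k)).const_add r).add
      ((hasDerivAt_id t).pow 2)).add ((h1.const_add p₀).pow 2)
    refine ((h3.const_mul ε).const_add m).congr_deriv ?_
    simp only [R', id]
    push_cast
    ring
  have hP : ∀ᶠ t in 𝓝 0, HasDerivAt P (P' t) t := by
    filter_upwards [ha'] with t h2
    have h3 : HasDerivAt (fun t => ∑ i, a i t ^ 2) (P' t) t :=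
      HasDerivAt.fun_sum fun i _ => ((h2 i).pow 2).congr_deriv (by simp)
    exact h3.const_add 1
  have hψ1 := hψ.self_of_nhds
  have ha1 := ha'.self_of_nhds
  have hQ' : HasDerivAt Q' (-∑ i, q i * c i - b k 0) 0 := by
    have h3 : HasDerivAt (fun t => ∑ i, q i * b i t) (∑ i, q i * c i) 0 :=
      HasDerivAt.fun_sum fun i _ => (hb i).const_mul (q i)
    refine (h3.neg.sub ((hasDerivAt_id 0).mul (hb k))).congr_deriv ?_
    simp
  have hR' : HasDerivAt R' (ε * (2 + 2 * p₀ * b k 0)) 0 := by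
    have h3 := (((hasDerivAt_id (0 : ℝ)).const_mul 2).const_add (2 * q k)).add
      (((hψ1.const_add p₀).const_mul 2).mul (ha1 k))
    refine (h3.const_mul ε).congr_deriv ?_
    simp [ha0, hψ0]
  have hP' : HasDerivAt P' (∑ i, 2 * b i 0 ^ 2) 0 := by
    refine HasDerivAt.fun_sum fun i _ => ?_
    refine (((ha1 i).const_mul 2).mul (hb i)).congr_deriv ?_
    rw [ha0]
    ring
  have hQ0 : Q 0 = p₀ := by simp [Q, hψ0, ha0]
  have hR0 : R 0 = p₀ ^ 2 := by simp [R, hψ0, h0]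
  have hP0 : P 0 = 1 := by simp [P, ha0]
  have hP'0 : P' 0 = 0 := by simp [P', ha0]
  have hR'0 : R' 0 = 2 * ε * q k := by simp [R', ha0]; ring
  have hQ'0 : Q' 0 = -∑ i, q i * b i 0 := by simp [Q']
  have hK : ∀ᶠ t in 𝓝 0, HasDerivAt (fun t => Q t * Q t - R t * P t)
      (Q' t * Q t + Q t * Q' t - (R' t * P t + R t * P' t)) t := by
    filter_upwards [hQ, hR, hP] with t h1 h2 h3
    exact (h1.mul h1).sub (h2.mul h3)
  have hQ1 := hQ.self_of_nhds
  have hR1 := hR.self_of_nhds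
  have hP1 := hP.self_of_nhds
  have hK' := ((hQ'.mul hQ1).add (hQ1.mul hQ')).sub ((hR'.mul hP1).add (hR1.mul hP'))
  have hloc : IsLocalMax (fun t => Q t * Q t - R t * P t) 0 := by
    filter_upwards [hmax] with t ht
    have ht' : Q t ^ 2 ≤ R t * P t := ht
    have : Q 0 * Q 0 - R 0 * P 0 = 0 := by rw [hQ0, hR0, hP0]; ring
    simp only [this]
    nlinarith
  obtain ⟨h1, h2⟩ := second_deriv_nonpos_of_isLocalMax hK hK' hloc
  simp only [hQ0, hR0, hP0, hP'0, hR'0, hQ'0] at h1 h2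
  rw [← Finset.mul_sum] at h2
  constructor <;> nlinarith

end MCFGap

namespace MCFGap

variable {n : ℕ} {S : Set (E (n + 1))} {V : Set (E n)}
variable {p ν : E (n + 1)} {ι : E n →ₗᵢ[ℝ] E (n + 1)} {φ : E n → ℝ}

/-! ### The geometry of a graph -/

/-- The gradient of `φ` at `u`. -/
noncomputable def grad (φ : E n → ℝ) (u : E n) : E n := WithLp.toLp 2 fun i => pderiv φ i u

theorem inner_grad (φ : E n → ℝ) (u w : E n) : inner ℝ w (grad φ u) = ∑ i, w i * pderiv φ i u := by
  simp [grad, PiLp.inner_apply, mul_comm]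

theorem norm_grad_sq (φ : E n → ℝ) (u : E n) : ‖grad φ u‖ ^ 2 = ∑ i, pderiv φ i u ^ 2 := by
  simp [grad, EuclideanSpace.norm_sq_eq]

theorem graph_eq (hν : ‖ν‖ = 1) (hι : ∀ u, inner ℝ (ι u) ν = 0) (u : E n) :
    graph p ν ι φ u = ι (tangentialPart ι p + u) + (inner ℝ p ν + φ u) • ν := by
  have h := isometry_tangentialPart_add hν hι p
  conv_lhs => rw [graph, ← h]
  rw [map_add, add_smul]
  abel

theorem norm_isometry_add_sq (hν : ‖ν‖ = 1) (hι : ∀ u, inner ℝ (ι u) ν = 0) (w : E n) (s : ℝ) :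
    ‖ι w + s • ν‖ ^ 2 = ‖w‖ ^ 2 + s ^ 2 := by
  rw [norm_add_sq_real, inner_smul_right, hι, norm_smul, hν, ι.norm_map, Real.norm_eq_abs,
    mul_one, sq_abs]
  ring

theorem inner_isometry_add (hν : ‖ν‖ = 1) (hι : ∀ u, inner ℝ (ι u) ν = 0) (w w' : E n)
    (s s' : ℝ) : inner ℝ (ι w + s • ν) (ι w' + s' • ν) = inner ℝ w w' + s * s' := by
  have hι' : ∀ u, inner ℝ ν (ι u) = 0 := fun u => by rw [real_inner_comm, hι]
  simp only [inner_add_left, inner_add_right, inner_smul_left, inner_smul_right, hι, hι',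
    ι.inner_map_map, real_inner_self_eq_norm_sq, hν]
  simp [mul_comm]

namespace IsGraphParam

theorem isOpen (h : IsGraphParam S p ν ι φ V) : IsOpen V := h.param.isOpen

theorem graph_zero (h : IsGraphParam S p ν ι φ V) : graph p ν ι φ 0 = p := by
  simp [graph, h.map_zero]

theorem pderiv_zero (h : IsGraphParam S p ν ι φ V) (i : Fin n) : pderiv φ i 0 = 0 := by
  simp [pderiv, h.fderiv_zero]

theorem pd_graph (h : IsGraphParam S p ν ι φ V) {u : E n} (hu : u ∈ V) (i : Fin n) :
    pd (graph p ν ι φ) i u = ι (EuclideanSpace.single i 1) + pderiv φ i u • ν :=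
  fderiv_graph_apply (differentiableAt_of_contDiffOn h.smooth h.isOpen hu) _

theorem metric_graph (h : IsGraphParam S p ν ι φ V) {u : E n} (hu : u ∈ V) :
    metric (graph p ν ι φ) u =
      1 + Matrix.vecMulVec (fun i => pderiv φ i u) fun i => pderiv φ i u := by
  ext i j
  simp only [metric, Matrix.of_apply, h.pd_graph hu,
    inner_isometry_add h.norm_normal h.inner_normal, Matrix.add_apply, Matrix.vecMulVec_apply,
    Matrix.one_apply, EuclideanSpace.inner_single_left]
  simp

theorem secondForm_graph (h : IsGraphParam S p ν ι φ V) {u : E n} (hu : u ∈ V) (v : E (n + 1))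
    (i j : Fin n) : secondForm (graph p ν ι φ) u v i j =
      -(pderiv (pderiv φ j) i u * inner ℝ ν v) := by
  have h1 : (fun w => pd (graph p ν ι φ) j w) =ᶠ[𝓝 u]
      fun w => ι (EuclideanSpace.single j 1) + pderiv φ j w • ν :=
    Filter.eventually_of_mem (h.isOpen.mem_nhds hu) fun w hw => h.pd_graph hw j
  have h2 := ((differentiableAt_of_contDiffOn (contDiffOn_pderiv h.smooth h.isOpen j) h.isOpen
    hu).hasFDerivAt.smul_const ν).const_add (ι (EuclideanSpace.single j 1))
  simp only [secondForm, Matrix.of_apply, h1.fderiv_eq, h2.fderiv]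
  simp [inner_smul_left, pderiv]

theorem isUnitNormal_smul (h : IsGraphParam S p ν ι φ V) {u : E n} (hu : u ∈ V) :
    IsUnitNormal (graph p ν ι φ) u
      ((Real.sqrt (1 + ∑ i, pderiv φ i u ^ 2))⁻¹ • (ι (-grad φ u) + (1 : ℝ) • ν)) := by
  have hpos : 0 < 1 + ∑ i, pderiv φ i u ^ 2 := by positivity
  constructor
  · have h1 : ‖ι (-grad φ u) + (1 : ℝ) • ν‖ = Real.sqrt (1 + ∑ i, pderiv φ i u ^ 2) := by
      rw [← Real.sqrt_sq (norm_nonneg _), norm_isometry_add_sq h.norm_normal h.inner_normal,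
        norm_neg, norm_grad_sq]
      ring_nf
    rw [norm_smul, h1, Real.norm_of_nonneg (by positivity)]
    exact inv_mul_cancel₀ (Real.sqrt_pos.2 hpos).ne'
  · intro i
    rw [h.pd_graph hu, inner_smul_left, inner_isometry_add h.norm_normal h.inner_normal,
      inner_neg_left, real_inner_comm, inner_grad]
    simp

theorem inner_graph_normal (h : IsGraphParam S p ν ι φ V) (u : E n) :
    inner ℝ (graph p ν ι φ u) (ι (-grad φ u) + (1 : ℝ) • ν) =
      inner ℝ p ν + φ u - ∑ i, (tangentialPart ι p i + u i) * pderiv φ i u := by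
  rw [graph_eq h.norm_normal h.inner_normal, inner_isometry_add h.norm_normal h.inner_normal,
    inner_neg_right, inner_grad]
  simp only [PiLp.add_apply]
  ring

theorem norm_graph_sq (h : IsGraphParam S p ν ι φ V) (u : E n) :
    ‖graph p ν ι φ u‖ ^ 2 = ‖tangentialPart ι p + u‖ ^ 2 + (inner ℝ p ν + φ u) ^ 2 := by
  rw [graph_eq h.norm_normal h.inner_normal, norm_isometry_add_sq h.norm_normal h.inner_normal]

end IsGraphParam

/-- The Sherman–Morrison formula; here it inverts the metric of a graph. -/
theorem inv_one_add_vecMulVec (a : Fin n → ℝ) :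
    (1 + Matrix.vecMulVec a a)⁻¹ = 1 - (1 + ∑ i, a i ^ 2)⁻¹ • Matrix.vecMulVec a a := by
  have hne : 1 + ∑ i, a i ^ 2 ≠ 0 := by positivity
  refine Matrix.inv_eq_right_inv ?_
  have h1 : Matrix.vecMulVec a a * Matrix.vecMulVec a a =
      (∑ i, a i ^ 2) • Matrix.vecMulVec a a := by
    ext i j
    simp only [Matrix.mul_apply, Matrix.vecMulVec_apply, Matrix.smul_apply, smul_eq_mul,
      Finset.sum_mul]
    exact Finset.sum_congr rfl fun k _ => by ring
  rw [add_mul, one_mul, mul_sub, mul_one, Matrix.mul_smul, h1, smul_smul]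
  ext i j
  simp only [Matrix.add_apply, Matrix.sub_apply, Matrix.smul_apply, smul_eq_mul]
  field_simp
  ring

/-- The equation of self-shrinkers for a graph. -/
theorem IsGraphParam.shrinker_equation (h : IsGraphParam S p ν ι φ V) (hS : IsSelfShrinker S)
    {u : E n} (hu : u ∈ V) :
    (1 + ∑ i, pderiv φ i u ^ 2) *
        (inner ℝ p ν + φ u - ∑ i, (tangentialPart ι p i + u i) * pderiv φ i u) =
      -((1 + ∑ i, pderiv φ i u ^ 2) * ∑ i, pderiv (pderiv φ i) i u
        - ∑ i, ∑ j, pderiv φ i u * pderiv φ j u * pderiv (pderiv φ j) i u) := by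
  have hpos : 0 < 1 + ∑ i, pderiv φ i u ^ 2 := by positivity
  have hs := (Real.sqrt_pos.2 hpos).ne'
  have heq := hS.equation _ _ h.param u hu _ (h.isUnitNormal_smul hu)
  rw [inner_smul_right, h.inner_graph_normal] at heq
  have hin : inner ℝ ν (ι (-grad φ u) + (1 : ℝ) • ν) = 1 := by
    have := inner_isometry_add h.norm_normal h.inner_normal 0 (-grad φ u) 1 1
    simpa using this
  simp only [meanCurvature, h.metric_graph hu, inv_one_add_vecMulVec, h.secondForm_graph hu,
    inner_smul_right, hin, Matrix.sub_apply, Matrix.smul_apply, Matrix.vecMulVec_apply,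
    smul_eq_mul] at heq
  -- Both sides carry the factor `W⁻¹` of the normalized normal. Cancelling it and clearing `P⁻¹`
  -- leaves an equation polynomial in the derivatives of `φ`, easy to differentiate.
  set W := Real.sqrt (1 + ∑ i, pderiv φ i u ^ 2)
  set P := 1 + ∑ i, pderiv φ i u ^ 2
  have hl : (∑ i, ∑ j, ((1 : Matrix (Fin n) (Fin n) ℝ) i j
        - P⁻¹ * (pderiv φ i u * pderiv φ j u)) * -(pderiv (pderiv φ j) i u * (W⁻¹ * 1))) =
      -W⁻¹ * (∑ i, pderiv (pderiv φ i) i u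
        - P⁻¹ * ∑ i, ∑ j, pderiv φ i u * pderiv φ j u * pderiv (pderiv φ j) i u) := by
    have h1 : ∑ i, pderiv (pderiv φ i) i u =
        ∑ i, ∑ j, (1 : Matrix (Fin n) (Fin n) ℝ) i j * pderiv (pderiv φ j) i u := by
      simp [Matrix.one_apply]
    rw [h1]
    simp only [Finset.mul_sum, ← Finset.sum_sub_distrib]
    exact Finset.sum_congr rfl fun i _ => Finset.sum_congr rfl fun j _ => by ring
  rw [hl] at heq
  have hP : P ≠ 0 := hpos.ne'
  field_simp at heq
  linarith

/-- At the base point the gradient vanishes, so the metric is the identity and `A` is the Hessian up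
to sign. Dilation by `c` divides `|A|` by `c`. -/
theorem normA_const_smul_graph_zero (h : IsGraphParam S p ν ι φ V) {c : ℝ} (hc : 0 < c) :
    c * normA (fun u => c • graph p ν ι φ u) 0 ν =
      Real.sqrt (∑ i, ∑ k, pderiv (pderiv φ k) i 0 ^ 2) := by
  have hpd : ∀ i, ∀ u ∈ V, pd (fun u => c • graph p ν ι φ u) i u = c • pd (graph p ν ι φ) i u := by
    intro i u hu
    simp only [pd]
    rw [fderiv_fun_const_smul (h.param.differentiableAt hu)]
    rfl
  have hm : (metric (fun u => c • graph p ν ι φ u) 0)⁻¹ = (c ^ 2)⁻¹ • 1 := by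
    refine Matrix.inv_eq_right_inv ?_
    have h1 : metric (fun u => c • graph p ν ι φ u) 0 = c ^ 2 • metric (graph p ν ι φ) 0 := by
      ext i j
      simp only [metric, Matrix.of_apply, hpd _ 0 h.zero_mem, inner_smul_left, inner_smul_right,
        Matrix.smul_apply, smul_eq_mul]
      simp
      ring
    have h2 : metric (graph p ν ι φ) 0 = 1 := by
      rw [h.metric_graph h.zero_mem]
      ext i j
      simp [Matrix.vecMulVec_apply, h.pderiv_zero]
    rw [h1, h2, Matrix.smul_mul, Matrix.mul_smul, smul_smul, one_mul,
      mul_inv_cancel₀ (by positivity), one_smul]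
  have hsf : ∀ i j, secondForm (fun u => c • graph p ν ι φ u) 0 ν i j =
      -(c * pderiv (pderiv φ j) i 0) := by
    intro i j
    have h1 : (fun w => pd (fun u => c • graph p ν ι φ u) j w) =ᶠ[𝓝 0]
        fun w => c • (ι (EuclideanSpace.single j 1) + pderiv φ j w • ν) :=
      Filter.eventually_of_mem (h.isOpen.mem_nhds h.zero_mem) fun w hw => by
        simp only [hpd j w hw, h.pd_graph hw j]
    have h2 := (((differentiableAt_of_contDiffOn (contDiffOn_pderiv h.smooth h.isOpen j) h.isOpen
      h.zero_mem).hasFDerivAt.smul_const ν).const_add (ι (EuclideanSpace.single j 1))).const_smul c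
    have h3 := h2.fderiv
    simp only [secondForm, Matrix.of_apply, h1.fderiv_eq]
    erw [h3]
    simp [inner_smul_left, pderiv, h.norm_normal]
  have hsum : (∑ i, ∑ j, ∑ k, ∑ l, ((c ^ 2)⁻¹ • (1 : Matrix (Fin n) (Fin n) ℝ)) i j *
      ((c ^ 2)⁻¹ • (1 : Matrix (Fin n) (Fin n) ℝ)) k l *
      -(c * pderiv (pderiv φ k) i 0) * -(c * pderiv (pderiv φ l) j 0)) =
      (c⁻¹) ^ 2 * ∑ i, ∑ k, pderiv (pderiv φ k) i 0 ^ 2 := by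
    rw [Finset.mul_sum]
    refine Finset.sum_congr rfl fun i _ => ?_
    rw [Finset.sum_eq_single i (fun j _ hj => by simp [Matrix.one_apply_ne hj.symm]) (by simp),
      Finset.mul_sum]
    refine Finset.sum_congr rfl fun k _ => ?_
    rw [Finset.sum_eq_single k (fun j _ hj => by simp [Matrix.one_apply_ne hj.symm]) (by simp)]
    simp only [Matrix.smul_apply, Matrix.one_apply_eq, smul_eq_mul, mul_one]
    field_simp
  simp only [normA, hm, hsf]
  rw [hsum, Real.sqrt_mul (by positivity), Real.sqrt_sq (by positivity), ← mul_assoc,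
    mul_inv_cancel₀ hc.ne', one_mul]

end MCFGap

namespace MCFGap

variable {n : ℕ} {S : Set (E (n + 1))} {V : Set (E n)}
variable {p ν : E (n + 1)} {ι : E n →ₗᵢ[ℝ] E (n + 1)} {φ : E n → ℝ}

/-! ### The maximum principle for `⟨x, ν⟩²` -/

namespace IsGraphParam

theorem inner_eq_neg_laplacian (h : IsGraphParam S p ν ι φ V) (hS : IsSelfShrinker S) :
    inner ℝ p ν = -∑ i, pderiv (pderiv φ i) i 0 := by
  have := h.shrinker_equation hS h.zero_mem
  simpa [h.pderiv_zero, h.map_zero] using this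

/-- Cauchy–Schwarz for the trace: `H² ≤ n |A|²`. -/
theorem inner_sq_le (h : IsGraphParam S p ν ι φ V) (hS : IsSelfShrinker S) :
    inner ℝ p ν ^ 2 ≤ n * ∑ i, ∑ k, pderiv (pderiv φ k) i 0 ^ 2 := by
  rw [h.inner_eq_neg_laplacian hS, neg_sq]
  calc (∑ i, pderiv (pderiv φ i) i 0) ^ 2
      ≤ n * ∑ i, pderiv (pderiv φ i) i 0 ^ 2 := by
        simpa using sq_sum_le_card_mul_sum_sq (s := Finset.univ)
          (f := fun i => pderiv (pderiv φ i) i 0)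
    _ ≤ _ := by
        gcongr with i
        exact Finset.single_le_sum (f := fun k => pderiv (pderiv φ k) i 0 ^ 2)
          (fun k _ => sq_nonneg _) (Finset.mem_univ i)

theorem sum_add_line_mul (q : E n) (a : Fin n → ℝ) (k : Fin n) (t : ℝ) :
    ∑ i, (q i + (t • EuclideanSpace.single k (1 : ℝ) : E n) i) * a i =
      ∑ i, q i * a i + t * a k := by
  simp [add_mul, Finset.sum_add_distrib]

/-- The derivative of the equation of self-shrinkers at the base point of a graph. -/
theorem pderiv_laplacian (h : IsGraphParam S p ν ι φ V) (hS : IsSelfShrinker S) (k : Fin n) :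
    ∑ i, pderiv (pderiv (pderiv φ i) i) k 0 =
      ∑ i, tangentialPart ι p i * pderiv (pderiv φ i) k 0 := by
  set q := tangentialPart ι p
  let e : E n := EuclideanSpace.single k (1 : ℝ)
  have hs1 := fun i => contDiffOn_pderiv h.smooth h.isOpen i
  have hs2 := fun i j => contDiffOn_pderiv (hs1 i) h.isOpen j
  have h0 : (0 : ℝ) • EuclideanSpace.single k (1 : ℝ) ∈ V := by simpa using h.zero_mem
  have hφ := hasDerivAt_comp_line h.smooth h.isOpen k h0
  have ha := fun i => hasDerivAt_comp_line (hs1 i) h.isOpen k h0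
  have hb := fun i j => hasDerivAt_comp_line (hs2 i j) h.isOpen k h0
  -- Since `∇φ` vanishes at `0`, `P` is stationary there and the terms quadratic in `∇φ` contribute
  -- nothing. What survives is `∂ₖ Δφ` and the Hessian applied to `q`.
  have hP : HasDerivAt (fun t : ℝ => 1 + ∑ i, pderiv φ i (t • e) ^ 2) 0 0 := by
    have : HasDerivAt (fun t : ℝ => ∑ i, pderiv φ i (t • e) ^ 2) (∑ i : Fin n, 0) 0 :=
      HasDerivAt.fun_sum fun i _ => ((ha i).pow 2).congr_deriv (by simp [h.pderiv_zero])
    simpa using this.const_add 1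
  have hQ : HasDerivAt (fun t : ℝ => inner ℝ p ν + φ (t • e) -
      (∑ i, q i * pderiv φ i (t • e) + t * pderiv φ k (t • e)))
      (-∑ i, q i * pderiv (pderiv φ i) k 0) 0 := by
    have h3 : HasDerivAt (fun t : ℝ => ∑ i, q i * pderiv φ i (t • e))
        (∑ i, q i * pderiv (pderiv φ i) k ((0 : ℝ) • e)) 0 :=
      HasDerivAt.fun_sum fun i _ => (ha i).const_mul (q i)
    refine ((hφ.const_add _).sub (h3.add ((hasDerivAt_id 0).mul (ha k)))).congr_deriv ?_
    simp [h.pderiv_zero]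
  have hL : HasDerivAt (fun t : ℝ => ∑ i, pderiv (pderiv φ i) i (t • e))
      (∑ i, pderiv (pderiv (pderiv φ i) i) k 0) 0 := by
    have : HasDerivAt (fun t : ℝ => ∑ i, pderiv (pderiv φ i) i (t • e))
        (∑ i, pderiv (pderiv (pderiv φ i) i) k ((0 : ℝ) • e)) 0 :=
      HasDerivAt.fun_sum fun i _ => hb i i
    simpa using this
  have hD : HasDerivAt (fun t : ℝ => ∑ i, ∑ j, pderiv φ i (t • e) * pderiv φ j (t • e) *
      pderiv (pderiv φ j) i (t • e)) (∑ i : Fin n, ∑ j : Fin n, 0) 0 :=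
    HasDerivAt.fun_sum fun i _ => HasDerivAt.fun_sum fun j _ =>
      (((ha i).mul (ha j)).mul (hb j i)).congr_deriv (by simp [h.pderiv_zero])
  have h1 := hP.mul hQ
  have h2 := ((hP.mul hL).sub hD).neg
  have h3 := h1.unique (h2.congr_of_eventuallyEq ?_)
  · simp [h.pderiv_zero] at h3
    linarith
  · filter_upwards [eventually_line_mem h.isOpen h.zero_mem e] with t ht
    have := h.shrinker_equation hS ht
    rw [sum_add_line_mul q (fun i => pderiv φ i (t • e)) k t] at this
    simpa using this

/-- If `⟨x, ν⟩² - ε ‖x‖²` is maximal at the base point of a graph, then `⟨x, ν⟩` is small there. -/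
theorem inner_sq_mul_le_of_max (h : IsGraphParam S p ν ι φ V) (hS : IsSelfShrinker S) {ε : ℝ}
    (hε : 0 ≤ ε)
    (hmax : ∀ x ∈ S, ∀ v, IsNormalTo S x v →
      inner ℝ x v ^ 2 - ε * ‖x‖ ^ 2 ≤ inner ℝ p ν ^ 2 - ε * ‖p‖ ^ 2) :
    inner ℝ p ν ^ 2 * (1 - ∑ i, ∑ k, pderiv (pderiv φ k) i 0 ^ 2) ≤ n * ε := by
  set q := tangentialPart ι p with hq
  set p₀ : ℝ := inner ℝ p ν with hp₀
  have hs1 := fun i => contDiffOn_pderiv h.smooth h.isOpen i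
  have hs2 := fun i j => contDiffOn_pderiv (hs1 i) h.isOpen j
  have hnp : ‖p‖ ^ 2 = ‖q‖ ^ 2 + p₀ ^ 2 := by
    have := h.norm_graph_sq 0
    rwa [h.graph_zero, h.map_zero, add_zero, add_zero] at this
  have key : ∀ k, p₀ * (-∑ i, q i * pderiv (pderiv φ i) k 0) = ε * q k ∧
      (∑ i, q i * pderiv (pderiv φ i) k 0) ^ 2
        - p₀ * (∑ i, q i * pderiv (pderiv (pderiv φ i) k) k 0 + pderiv (pderiv φ k) k 0)
        - ε * (1 + p₀ * pderiv (pderiv φ k) k 0)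
        - p₀ ^ 2 * ∑ i, pderiv (pderiv φ i) k 0 ^ 2 ≤ 0 := by
    intro k
    let e : E n := EuclideanSpace.single k (1 : ℝ)
    have hmem := eventually_line_mem h.isOpen h.zero_mem e
    have h0 : (0 : ℝ) • EuclideanSpace.single k (1 : ℝ) ∈ V := by simpa using h.zero_mem
    have := max_conditions_along_line (a := fun i t => pderiv φ i (t • e))
      (b := fun i t => pderiv (pderiv φ i) k (t • e))
      (c := fun i => pderiv (pderiv (pderiv φ i) k) k ((0 : ℝ) • e))
      (q := fun i => q i) (ψ := fun t => φ (t • e)) (k := k) (p₀ := p₀)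
      (m := p₀ ^ 2 - ε * ‖p‖ ^ 2) (r := ‖q‖ ^ 2) (ε := ε)
      (hmem.mono fun t ht => hasDerivAt_comp_line h.smooth h.isOpen k ht)
      (fun i => hmem.mono fun t ht => hasDerivAt_comp_line (hs1 i) h.isOpen k ht)
      (fun i => hasDerivAt_comp_line (hs2 i k) h.isOpen k h0)
      (by simp [h.map_zero]) (by simp [h.pderiv_zero]) (by rw [hnp]; ring) ?_
    · simpa only [zero_smul] using this
    · filter_upwards [hmem] with t ht
      have hpos : 0 < 1 + ∑ i, pderiv φ i (t • e) ^ 2 := by positivity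
      have h1 := hmax _ (h.param.mem ht) _
        ((h.param.isUnitNormal_iff ht _).1 (h.isUnitNormal_smul ht))
      have hsum := sum_add_line_mul q (fun i => pderiv φ i (t • e)) k t
      have hnorm : ‖q + t • e‖ ^ 2 = ‖q‖ ^ 2 + 2 * t * q k + t ^ 2 := by
        rw [norm_add_sq_real, inner_smul_right, norm_smul, mul_pow, Real.norm_eq_abs, sq_abs]
        simp [e, EuclideanSpace.inner_single_right]
        ring
      rw [inner_smul_right, h.inner_graph_normal, h.norm_graph_sq, ← hq, ← hp₀, mul_pow, inv_pow,
        Real.sq_sqrt hpos.le, hnorm, hsum, inv_mul_eq_div] at h1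
      have h3 := (div_le_iff₀ hpos).1 (sub_le_iff_le_add.1 h1)
      rwa [← sub_sub] at h3
  set B : Fin n → ℝ := fun k => ∑ i, q i * pderiv (pderiv φ i) k 0 with hB
  -- Symmetry of third derivatives (the Codazzi equation) turns the sum over `k` into `∂ᵢ Δφ`, which
  -- the differentiated shrinker equation evaluates.
  have hc : ∀ i k, pderiv (pderiv (pderiv φ i) k) k 0 = pderiv (pderiv (pderiv φ k) k) i 0 := by
    intro i k
    rw [pderiv_congr h.isOpen (fun u hu => pderiv_comm h.smooth h.isOpen i k hu) h.zero_mem,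
      pderiv_comm (hs1 k) h.isOpen i k h.zero_mem]
  have hcs : ∑ k, ∑ i, q i * pderiv (pderiv (pderiv φ i) k) k 0 = ∑ i, q i * B i := by
    rw [Finset.sum_comm]
    refine Finset.sum_congr rfl fun i _ => ?_
    rw [← Finset.mul_sum, Finset.sum_congr rfl fun k _ => hc i k, h.pderiv_laplacian hS i]
  -- The first-order conditions `-p₀ Bₖ = ε qₖ`, weighted by `qₖ` and summed, remove the gradient
  -- term.
  have hqB : p₀ * ∑ i, q i * B i = -(ε * ∑ i, q i ^ 2) := by
    rw [Finset.mul_sum, Finset.mul_sum, ← Finset.sum_neg_distrib]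
    refine Finset.sum_congr rfl fun i _ => ?_
    linear_combination -q i * (key i).1
  have hsum := Finset.sum_nonpos fun k (_ : k ∈ Finset.univ) => (key k).2
  simp only [Finset.sum_sub_distrib, ← Finset.mul_sum, Finset.sum_add_distrib] at hsum
  rw [hcs] at hsum
  have hlap := h.inner_eq_neg_laplacian hS
  rw [← hp₀] at hlap
  have hlap' : ∑ i, pderiv (pderiv φ i) i 0 = -p₀ := by linarith
  rw [hlap'] at hsum
  simp only [Finset.sum_const, Finset.card_univ, Fintype.card_fin, nsmul_eq_mul, mul_one] at hsum
  have hB2 : 0 ≤ ∑ k, B k ^ 2 := by positivity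
  have hq2 : 0 ≤ ε * ∑ i, q i ^ 2 := by positivity
  have hp2 : 0 ≤ ε * p₀ ^ 2 := by positivity
  -- The sum reads `p₀² (1 - |A|²) ≤ n ε - |B|² - ε |q|² - ε p₀²`; the last three terms are dropped.
  nlinarith

end IsGraphParam

/-- On a closed self-shrinker with `|A| ≤ C < 1`, the support function `⟨x, ν⟩` vanishes. -/
theorem inner_eq_zero_of_secondForm_bound (hS : IsSelfShrinker S) (hcl : IsClosed S) {D : ℝ}
    (hD : D < 1)
    (hA : ∀ p ν ι φ V, IsGraphParam S p ν ι φ V →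
      ∑ i, ∑ k, pderiv (pderiv φ k) i 0 ^ 2 ≤ D)
    {x v : E (n + 1)} (hx : x ∈ S) (hv : IsNormalTo S x v) : inner ℝ x v = 0 := by
  have hb : ∀ y ∈ S, ∀ w, IsNormalTo S y w → inner ℝ y w ^ 2 ≤ n * D := by
    intro y hy w hw
    obtain ⟨ι, φ, V, h⟩ := hw.exists_isGraphParam hS.hypersurface hy
    exact (h.inner_sq_le hS).trans (by gcongr; exact hA _ _ _ _ _ h)
  have hε : ∀ ε > 0, inner ℝ x v ^ 2 ≤ ε * (n / (1 - D) + ‖x‖ ^ 2) := by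
    intro ε hε
    let B : Set (E (n + 1) × E (n + 1)) := {q | q.1 ∈ S ∧ IsNormalTo S q.1 q.2}
    let G : E (n + 1) × E (n + 1) → ℝ := fun q => inner ℝ q.1 q.2 ^ 2 - ε * ‖q.1‖ ^ 2
    have hG : Continuous G := by fun_prop
    have hmax : ∃ q ∈ B, IsMaxOn G B q := by
      refine hG.continuousOn.exists_isMaxOn' (isClosed_normalBundle hS.hypersurface hcl)
        (x₀ := (x, v)) ⟨hx, hv⟩ ?_
      obtain ⟨r, hr⟩ : ∃ r : ℝ, ∀ q ∈ B, r < ‖q‖ → G q ≤ G (x, v) := by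
        -- Beyond norm `1` the sup norm of a pair with unit second entry is the norm of the point,
        -- and its square exceeds it. The other bound then makes `ε |x|²` outweigh the bound `n D`
        -- on `H²`.
        refine ⟨max 1 ((n * D - G (x, v)) / ε + 1), fun q hq hlt => ?_⟩
        have h1 : 1 < ‖q‖ := (le_max_left _ _).trans_lt hlt
        have h2 : (n * D - G (x, v)) / ε + 1 < ‖q‖ := (le_max_right _ _).trans_lt hlt
        have h3 : ‖q‖ = ‖q.1‖ := by
          rw [Prod.norm_def, hq.2.1] at h1 ⊢
          exact max_eq_left ((lt_max_iff.1 h1).resolve_right (lt_irrefl _)).le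
        have h4 : (n * D - G (x, v)) / ε ≤ ‖q.1‖ ^ 2 := by
          rw [h3] at h1 h2
          nlinarith
        rw [div_le_iff₀ hε] at h4
        have h5 := hb q.1 hq.1 q.2 hq.2
        simp only [G] at h4 ⊢
        linarith
      rw [Filter.eventually_inf_principal]
      have := (tendsto_norm_cocompact_atTop (E := E (n + 1) × E (n + 1))).eventually_gt_atTop r
      exact this.mono fun q hq hqB => hr q hqB hq
    obtain ⟨⟨y, w⟩, ⟨hy, hw⟩, hm⟩ := hmax
    obtain ⟨ι, φ, V, h⟩ := hw.exists_isGraphParam hS.hypersurface hy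
    have h1 := h.inner_sq_mul_le_of_max hS hε.le fun z hz u hu => hm (a := (z, u)) ⟨hz, hu⟩
    have h2 : inner ℝ y w ^ 2 * (1 - D) ≤ n * ε :=
      le_trans (by gcongr; exact hA _ _ _ _ _ h) h1
    have h3 : inner ℝ y w ^ 2 ≤ n * ε / (1 - D) := (le_div_iff₀ (by linarith)).2 h2
    have h4 : inner ℝ x v ^ 2 - ε * ‖x‖ ^ 2 ≤ inner ℝ y w ^ 2 - ε * ‖y‖ ^ 2 :=
      hm (a := (x, v)) ⟨hx, hv⟩
    have h5 : 0 ≤ ε * ‖y‖ ^ 2 := by positivity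
    have h6 : ε * (n / (1 - D) + ‖x‖ ^ 2) = n * ε / (1 - D) + ε * ‖x‖ ^ 2 := by ring
    linarith
  have hlim : Filter.Tendsto (fun ε : ℝ => ε * (n / (1 - D) + ‖x‖ ^ 2)) (𝓝[>] 0) (𝓝 0) := by
    have : Filter.Tendsto (fun ε : ℝ => ε * (n / (1 - D) + ‖x‖ ^ 2)) (𝓝 0) (𝓝 (0 * _)) :=
      Filter.tendsto_id.mul_const _
    rw [zero_mul] at this
    exact this.mono_left nhdsWithin_le_nhds
  have h0 : inner ℝ x v ^ 2 ≤ 0 :=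
    ge_of_tendsto hlim (Filter.eventually_of_mem self_mem_nhdsWithin fun ε h => hε ε h)
  exact pow_eq_zero_iff (two_ne_zero) |>.1 (le_antisymm h0 (sq_nonneg _))

end MCFGap

namespace MCFGap

variable {n : ℕ} {S : Set (E (n + 1))} {V : Set (E n)}
variable {p ν : E (n + 1)} {ι : E n →ₗᵢ[ℝ] E (n + 1)} {φ : E n → ℝ}

/-! ### Hypersurfaces with vanishing support function -/

theorem exists_isNormalTo (hS : IsSmoothHypersurface S) {x : E (n + 1)} (hx : x ∈ S) :
    ∃ v, IsNormalTo S x v := by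
  obtain ⟨f, V, hf, u, hu, rfl⟩ := hS x hx
  let K : Submodule ℝ (E (n + 1)) := LinearMap.range (fderiv ℝ f u : E n →ₗ[ℝ] E (n + 1))
  have hK : Kᗮ ≠ ⊥ := by
    intro h
    rw [Submodule.orthogonal_eq_bot_iff] at h
    have h1 : Module.finrank ℝ K ≤ n := by
      simpa using LinearMap.finrank_range_le (fderiv ℝ f u : E n →ₗ[ℝ] E (n + 1))
    rw [h, finrank_top] at h1
    simp at h1
  obtain ⟨w, hw, hw0⟩ := Submodule.exists_mem_ne_zero_of_ne_bot hK
  refine ⟨‖w‖⁻¹ • w, (hf.isUnitNormal_iff hu _).1 ⟨?_, fun i => ?_⟩⟩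
  · rw [norm_smul, norm_inv, norm_norm, inv_mul_cancel₀ (norm_ne_zero_iff.2 hw0)]
  · rw [inner_smul_left, real_inner_comm,
      (Submodule.mem_orthogonal K w).1 hw (pd f i u) ⟨_, rfl⟩, mul_zero]

/-- Here `p = ι q` is tangent, and `H = 0` on the graph is Euler's relation `φ u = dφ_u (q + u)`. So
`φ` is homogeneous of degree one about `-q`: `φ ((c - 1) q) / c` is constant in `c`, equal to its
value `0` at `c = 1`. -/
theorem IsGraphParam.eventually_smul_mem (h : IsGraphParam S p ν ι φ V)
    (hH : ∀ x ∈ S, ∀ v, IsNormalTo S x v → inner ℝ x v = 0) :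
    ∀ᶠ c : ℝ in 𝓝 1, c • p ∈ S := by
  set q := tangentialPart ι p with hq
  have hp : p ∈ S := h.graph_zero ▸ h.param.mem h.zero_mem
  have hnν : IsNormalTo S p ν := by
    have := (h.param.isUnitNormal_iff h.zero_mem ν).1
      ⟨h.norm_normal, fun i => by
        rw [h.pd_graph h.zero_mem, h.pderiv_zero, zero_smul, add_zero, real_inner_comm,
          h.inner_normal]⟩
    rwa [h.graph_zero] at this
  have hp0 : inner ℝ p ν = 0 := hH p hp ν hnν
  have hpq : ι q = p := by
    have := isometry_tangentialPart_add h.norm_normal h.inner_normal p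
    rwa [hp0, zero_smul, add_zero] at this
  have heq : ∀ u ∈ V, φ u = fderiv ℝ φ u (q + u) := by
    intro u hu
    have hpos : 0 < 1 + ∑ i, pderiv φ i u ^ 2 := by positivity
    have h1 := hH _ (h.param.mem hu) _
      ((h.param.isUnitNormal_iff hu _).1 (h.isUnitNormal_smul hu))
    rw [inner_smul_right, h.inner_graph_normal, hp0, zero_add] at h1
    have h2 := (mul_eq_zero.1 h1).resolve_left (inv_ne_zero (Real.sqrt_pos.2 hpos).ne')
    rw [fderiv_apply_eq_sum_pderiv]
    exact sub_eq_zero.1 h2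
  have hc : ContinuousAt (fun c : ℝ => (c - 1) • q) 1 := by fun_prop
  have hev : ∀ᶠ c : ℝ in 𝓝 1, (c - 1) • q ∈ V ∧ c ≠ 0 :=
    (hc.eventually_mem (by simpa using h.isOpen.mem_nhds h.zero_mem)).and
      (eventually_ne_nhds one_ne_zero)
  obtain ⟨δ, hδ, hball⟩ := Metric.eventually_nhds_iff_ball.1 hev
  have hd : ∀ c ∈ Metric.ball (1 : ℝ) δ,
      HasDerivAt (fun c : ℝ => φ ((c - 1) • q) / c) 0 c := by
    intro c hcb
    obtain ⟨hcV, hc0⟩ := hball c hcb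
    have h1 : HasDerivAt (fun c : ℝ => (c - 1) • q) q c := by
      simpa using ((hasDerivAt_id c).sub_const 1).smul_const q
    have h2 := (differentiableAt_of_contDiffOn h.smooth h.isOpen hcV).hasFDerivAt.comp_hasDerivAt
      c h1
    refine (h2.div (hasDerivAt_id c) hc0).congr_deriv ?_
    have h3 := heq _ hcV
    have h4 : q + (c - 1) • q = c • q := by module
    rw [h4, map_smul, smul_eq_mul] at h3
    simp only [Function.comp, id]
    rw [h3]
    simp [mul_comm]
  filter_upwards [Metric.ball_mem_nhds (1 : ℝ) hδ] with c hcb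
  have h1 : φ ((c - 1) • q) / c = φ (((1 : ℝ) - 1) • q) / 1 :=
    Metric.isOpen_ball.is_const_of_deriv_eq_zero (convex_ball (1 : ℝ) δ).isPreconnected
      (fun c hc => (hd c hc).differentiableAt.differentiableWithinAt)
      (fun c hc => (hd c hc).deriv) hcb (Metric.mem_ball_self hδ)
  obtain ⟨hcV, hc0⟩ := hball c hcb
  rw [sub_self, zero_smul, h.map_zero, zero_div] at h1
  have h2 : φ ((c - 1) • q) = 0 := (div_eq_zero_iff.1 h1).resolve_right hc0
  have h3 : graph p ν ι φ ((c - 1) • q) = c • p := by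
    rw [graph, h2, zero_smul, add_zero, map_smul, hpq]
    module
  exact h3 ▸ h.param.mem hcV

/-- The admissible factors form an open, relatively closed, non-empty subset of the connected
half-line `(0, ∞)`. -/
theorem smul_mem_of_inner_eq_zero (hS : IsSmoothHypersurface S) (hcl : IsClosed S)
    (hH : ∀ x ∈ S, ∀ v, IsNormalTo S x v → inner ℝ x v = 0) {x : E (n + 1)} (hx : x ∈ S)
    {c : ℝ} (hc : 0 < c) : c • x ∈ S := by
  let A : Set ℝ := {c | 0 < c ∧ c • x ∈ S}
  have hA : IsOpen A := by
    refine isOpen_iff_mem_nhds.2 fun a ⟨ha, haS⟩ => ?_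
    obtain ⟨v, hv⟩ := exists_isNormalTo hS haS
    obtain ⟨ι, φ, V, h⟩ := hv.exists_isGraphParam hS haS
    have h1 : ContinuousAt (fun b : ℝ => b / a) a := by fun_prop
    have h2 := h1.eventually (p := fun c : ℝ => c • a • x ∈ S)
      (by simpa only [div_self ha.ne'] using h.eventually_smul_mem hH)
    filter_upwards [h2, lt_mem_nhds ha] with b hb hb0
    rw [smul_smul, div_mul_cancel₀ _ ha.ne'] at hb
    exact ⟨hb0, hb⟩
  have hcl' : closure A ∩ Set.Ioi 0 ⊆ A := by
    rintro a ⟨ha, ha0⟩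
    refine ⟨ha0, ?_⟩
    have h1 : IsClosed {c : ℝ | c • x ∈ S} := hcl.preimage (by fun_prop)
    exact closure_minimal (fun c hc => hc.2) h1 ha
  exact (isPreconnected_Ioi.subset_of_closure_inter_subset hA
    ⟨1, zero_lt_one, zero_lt_one, by simpa using hx⟩ hcl' hc).2

theorem eq_hyperplane_of_inner_eq_zero (hS : IsSmoothHypersurface S) (hcl : IsClosed S)
    (hne : S.Nonempty) (hH : ∀ x ∈ S, ∀ v, IsNormalTo S x v → inner ℝ x v = 0) :
    ∃ W : Submodule ℝ (E (n + 1)), Module.finrank ℝ W = n ∧ S = W := by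
  have hcone : ∀ x ∈ S, ∀ c : ℝ, 0 < c → c • x ∈ S := fun x hx c hc =>
    smul_mem_of_inner_eq_zero hS hcl hH hx hc
  have h0 : (0 : E (n + 1)) ∈ S := by
    obtain ⟨x, hx⟩ := hne
    have h1 : Filter.Tendsto (fun c : ℝ => c • x) (𝓝[>] 0) (𝓝 0) := by
      have : Filter.Tendsto (fun c : ℝ => c • x) (𝓝 0) (𝓝 ((0 : ℝ) • x)) :=
        Continuous.tendsto (by fun_prop) 0
      rw [zero_smul] at this
      exact this.mono_left nhdsWithin_le_nhds
    exact hcl.mem_of_tendsto h1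
      (Filter.eventually_of_mem self_mem_nhdsWithin fun c hc => hcone x hx c hc)
  obtain ⟨ν, hν⟩ := exists_isNormalTo hS h0
  obtain ⟨ι, φ, V, h⟩ := hν.exists_isGraphParam hS h0
  -- Along a ray of the cone `⟨·, ν⟩` is linear, yet its derivative along `S` at `0` is zero. So
  -- every ray lies in the tangent hyperplane.
  have horth : ∀ x ∈ S, inner ℝ x ν = 0 := by
    intro x hx
    have h1 : HasDerivWithinAt (fun c : ℝ => c • x) x (Set.Ioi 0) 0 := by
      simpa using ((hasDerivAt_id (0 : ℝ)).smul_const x).hasDerivWithinAt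
    have h2 : HasFDerivWithinAt (fun y => inner ℝ y ν) (0 : E (n + 1) →L[ℝ] ℝ) S
        ((0 : ℝ) • x) := by
      rw [zero_smul]; exact hν.2
    have h3 : HasDerivWithinAt (fun c : ℝ => inner ℝ (c • x) ν) 0 (Set.Ioi 0) 0 := by
      have := h2.comp_hasDerivWithinAt (0 : ℝ) h1 fun c hc => hcone x hx c hc
      exact this
    have h4 : HasDerivWithinAt (fun c : ℝ => inner ℝ (c • x) ν) (inner ℝ x ν) (Set.Ioi 0) 0 := by
      simp only [inner_smul_left]
      simpa using ((hasDerivAt_id (0 : ℝ)).mul_const (inner ℝ x ν)).hasDerivWithinAt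
    exact (uniqueDiffWithinAt_Ioi (0 : ℝ)).eq_deriv _ h4 h3
  refine ⟨LinearMap.range ι.toLinearMap, finrank_range_isometry ι, Set.Subset.antisymm ?_ ?_⟩
  · intro x hx
    refine ⟨tangentialPart ι x, ?_⟩
    have := isometry_tangentialPart_add h.norm_normal h.inner_normal x
    rwa [horth x hx, zero_smul, add_zero] at this
  · rintro _ ⟨u, rfl⟩
    -- A small multiple of `u` lies in `V`. There the graph lies in `ν^⊥`, forcing `φ = 0`, and the
    -- cone property scales the point back.
    obtain ⟨c, hcV, hc⟩ := (((eventually_line_mem h.isOpen h.zero_mem u).filter_mono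
      nhdsWithin_le_nhds).and (self_mem_nhdsWithin (s := Set.Ioi (0 : ℝ)))).exists
    have hc' : (0 : ℝ) < c := hc
    have h1 := h.param.mem hcV
    have h2 := horth _ h1
    simp only [graph, zero_add, inner_add_left, inner_smul_left, h.inner_normal,
      real_inner_self_eq_norm_sq, h.norm_normal] at h2
    simp only [graph, zero_add] at h1
    have h3 : φ (c • u) = 0 := by simpa using h2
    rw [h3, zero_smul, add_zero, map_smul] at h1
    have h4 := hcone _ h1 c⁻¹ (inv_pos.2 hc')
    rwa [smul_smul, inv_mul_cancel₀ hc'.ne', one_smul] at h4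

/-- A closed non-empty self-shrinker with `|A| ≤ C < 1`, where `|A|` is measured on a homothetic
copy and renormalized, is a hyperplane through the origin. -/
theorem IsSelfShrinker.eq_hyperplane (hS : IsSelfShrinker S) (hcl : IsClosed S)
    (hne : S.Nonempty) {c C : ℝ} (hc : 0 < c) (hC : C < 1)
    (hA : ∀ a ∈ valuesA ((fun x => c • x) '' S), c * a ≤ C) :
    ∃ W : Submodule ℝ (E (n + 1)), Module.finrank ℝ W = n ∧ S = W := by
  -- `C` is not assumed nonnegative, so it is truncated at `0` before squaring.
  have hD : (max C 0) ^ 2 < 1 := by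
    have h1 : max C 0 < 1 := max_lt hC one_pos
    have h2 : 0 ≤ max C 0 := le_max_right _ _
    nlinarith
  refine eq_hyperplane_of_inner_eq_zero hS.hypersurface hcl hne fun x hx v hv =>
    inner_eq_zero_of_secondForm_bound hS hcl hD ?_ hx hv
  intro p ν ι φ V h
  have hn : IsUnitNormal (fun u => c • graph p ν ι φ u) 0 ν := by
    refine ⟨h.norm_normal, fun i => ?_⟩
    have h1 : pd (fun u => c • graph p ν ι φ u) i 0 = c • pd (graph p ν ι φ) i 0 := by
      simp only [pd]
      rw [fderiv_fun_const_smul (h.param.differentiableAt h.zero_mem)]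
      rfl
    rw [h1, inner_smul_right, h.pd_graph h.zero_mem, h.pderiv_zero, zero_smul, add_zero,
      real_inner_comm, h.inner_normal, mul_zero]
  have h1 := hA _ ⟨_, V, 0, ν, h.param.const_smul hc.ne', h.zero_mem, hn, rfl⟩
  rw [normA_const_smul_graph_zero h hc] at h1
  exact (Real.sqrt_le_left (le_max_right _ _)).1 (h1.trans (le_max_left _ _))

end MCFGap

theorem mainTheorem8 {n : ℕ} {M : Type*} [TopologicalSpace M] [T2Space M] [CompactSpace M]
    [ChartedSpace (MCFGap.E n) M] [IsManifold (𝓡 n) ∞ M]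
    (F : M → ℝ → MCFGap.E (n + 1)) (T : ℝ) (hF : MCFGap.IsMeanCurvatureFlow F T)
    (N : ℝ → Set (MCFGap.E (n + 1))) (hN : MCFGap.IsSelfShrinkingFlow N)
    (hne : (N (-1 / 2)).Nonempty) (hlim : MCFGap.IsBlowUpLimit F T N)
    (t₀ : ℝ) (ht₀ : t₀ < 0)
    (hA : ∃ C < 1, ∀ a ∈ MCFGap.valuesA (N t₀), Real.sqrt (-2 * t₀) * a ≤ C) :
    ∃ W : Submodule ℝ (MCFGap.E (n + 1)), Module.finrank ℝ W = n ∧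
      ∀ t < 0, N t = (W : Set (MCFGap.E (n + 1))) := by
  have hcl : IsClosed (N (-1 / 2)) := by
    obtain ⟨c, x, τ, -, -, -, h⟩ := hlim
    obtain ⟨μ, -, hμ, -⟩ := h (-1 / 2) (by norm_num)
    rw [hμ]
    exact MeasureTheory.Measure.isClosed_support
  have hsqrt : ∀ t < 0, 0 < Real.sqrt (-2 * t) := fun t ht => Real.sqrt_pos.2 (by linarith)
  obtain ⟨C, hC, hA⟩ := hA
  -- The slice at `t₀` is a dilate of the normalized one, so the bound on it transfers to `N
  -- (-1/2)`.
  rw [hN.scaling t₀ ht₀] at hA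
  obtain ⟨W, hW, hS⟩ := hN.selfShrinker.eq_hyperplane hcl hne (hsqrt t₀ ht₀) hC hA
  refine ⟨W, hW, fun t ht => ?_⟩
  rw [hN.scaling t ht, hS]
  ext y
  constructor
  · rintro ⟨w, hw, rfl⟩
    exact W.smul_mem _ hw
  · intro hy
    exact ⟨(Real.sqrt (-2 * t))⁻¹ • y, W.smul_mem _ hy, by
      simp only [smul_smul, mul_inv_cancel₀ (hsqrt t ht).ne', one_smul]⟩
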